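/- Let $M\ge 1$, let $\Omega_1\subset\mathbb R^M$ be a nonempty bounded connected open set contained in an open set $\Omega\subset\mathbb R^M$, and let $\int_{\partial\Omega_1}$ denote integration against the $(M-1)$-dimensional Hausdorff measure $\sigma$ on $\partial\Omega_1$. A function $g\in L^2(\partial\Omega_1)$ is a trace of $u\in H^1(\Omega_1)$ if there are $u_n\in H^1(\Omega_1)\cap C(\overline{\Omega_1})$ with $u_n|_{\partial\Omega_1}\in L^2(\partial\Omega_1)$, $u_n\to u$ in $H^1(\Omega_1)$ and $u_n|_{\partial\Omega_1}\to g$ in $L^2(\partial\Omega_1)$. Below, an element of $H^1(\Omega_1)$ is always understood together with a trace, which is used in all boundary integrals (if $\Omega_1$ has Lipschitz boundary, every $u\in H^1(\Omega_1)$ has exactly one trace, so this is no restriction). Let $\gamma>0$, $\underline a>0$, $\overline a\in\mathbb R$, and $\widetilde\gamma=\min\{1,\gamma\}$. Let $C_F>0$ be a constant in the Friedrichs inequality $$\|v\|_{H^1(\Omega_1)}^2\le C_F\Big[\int_{\Omega_1}|\nabla v|^2+\int_{\partial\Omega_1}v^2\Big]\qquad\text{for all } v\in H^1(\Omega_1),$$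 and let $0<\overline b<\underline a\,\widetilde\gamma/C_F$. Let $f\in L^\infty(\Omega)$ and let $b\in L^\infty(\Omega)$ satisfy $0<b<\overline b$ a.e. on $\Omega$. Let $\mathbb A$ be the set of measurable coefficients $a$ with $\underline a<a<\overline a$ a.e. on $\Omega$, given together with measurable boundary values on $\partial\Omega_1$ satisfying $\underline a\le a\le\overline a$ $\sigma$-a.e. on $\partial\Omega_1$. For every $a\in\mathbb A$ there is a unique $U(a)\in H^1(\Omega_1)$ (unique together with its trace) such that $$\int_{\Omega_1}a\nabla U(a)\cdot\nabla v+\int_{\partial\Omega_1}a\gamma\,U(a)\,v-\int_{\Omega_1}b\,U(a)\,v=\int_{\Omega_1}f v\qquad\text{for all } v\in H^1(\Omega_1),$$ and for every $z^\delta\in H^1(\Omega_1)$ the set $\mathbb A$ is convex and the functional $$G_{z^\delta}(a)=\frac12\int_{\Omega_1}a\,|\nabla(U(a)-z^\delta)|^2+\frac12\int_{\partial\Omega_1}a\gamma\,(U(a)-z^\delta)^2-\frac12\int_{\Omega_1}b\,(U(a)-z^\delta)^2$$ is convex on $\mathbb A$. -/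

import Mathlib

open MeasureTheory Filter Topology
open scoped ContDiff

namespace RobinEnergy

/-- The Euclidean space of dimension `M`. -/
abbrev Space (M : ℕ) : Type := EuclideanSpace ℝ (Fin M)

/-- The surface measure on the boundary of `Ω`: the `(M - 1)`-dimensional Hausdorff measure
(in its Euclidean normalization), restricted to the topological boundary. -/
noncomputable def surface {M : ℕ} (Ω : Set (Space M)) : Measure (Space M) :=
  (Measure.euclideanHausdorffMeasure (M - 1)).restrict (frontier Ω)

/-- `w` is the weak gradient of `u` in the open set `Ω`. -/
def IsWeakGrad {M : ℕ} (Ω : Set (Space M)) (u : Space M → ℝ) (w : Space M → Space M) : Prop :=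
  ∀ φ : Space M → ℝ, ContDiff ℝ ∞ φ → HasCompactSupport φ → tsupport φ ⊆ Ω →
    ∀ i : Fin M,
      ∫ x in Ω, u x * fderiv ℝ φ x (EuclideanSpace.single i 1) = - ∫ x in Ω, w x i * φ x

/-- The Sobolev space `H¹(Ω)`: square integrable functions with a square integrable weak gradient
(which the function determines). -/
structure H1 {M : ℕ} (Ω : Set (Space M)) where
  val : Lp ℝ 2 (volume.restrict Ω)
  grad : Lp (Space M) 2 (volume.restrict Ω)
  isWeakGrad : IsWeakGrad Ω val grad

/-- `g ∈ L²(∂Ω)` is a trace of `u ∈ H¹(Ω)`: some sequence of functions in `H¹(Ω)`, each with a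
representative `c n` that is continuous on the closure of `Ω`, converges to `u` in `H¹(Ω)`, while
the restrictions of the `c n` to the boundary converge to `g` in `L²(∂Ω)`. This is the extension by
continuity of the restriction map `u ↦ u|_∂Ω` on `H¹(Ω) ∩ C(closure Ω)`. -/
def H1.HasTrace {M : ℕ} {Ω : Set (Space M)} (u : H1 Ω) (g : Lp ℝ 2 (surface Ω)) : Prop :=
  ∃ (φ : ℕ → H1 Ω) (t : ℕ → Lp ℝ 2 (surface Ω)) (c : ℕ → Space M → ℝ),
    (∀ n, ContinuousOn (c n) (closure Ω) ∧
      (φ n).val =ᵐ[volume.restrict Ω] c n ∧ t n =ᵐ[surface Ω] c n) ∧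
    Tendsto (fun n => (φ n).val) atTop (𝓝 u.val) ∧
    Tendsto (fun n => (φ n).grad) atTop (𝓝 u.grad) ∧
    Tendsto t atTop (𝓝 g)

/-- A function in `H¹(Ω)` together with its trace. If `Ω` is a bounded Lipschitz domain, every
function in `H¹(Ω)` has exactly one trace, so that this is `H¹(Ω)` itself. -/
structure TracedH1 {M : ℕ} (Ω : Set (Space M)) extends H1 Ω where
  trace : Lp ℝ 2 (surface Ω)
  hasTrace : toH1.HasTrace trace

/-- `u` is a weak solution of `-div (a ∇u) - b u = f` in `Ω` with the Robin condition
`∇u · n + γ u = 0` on the boundary of `Ω`. -/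
def IsWeakSolution {M : ℕ} (Ω : Set (Space M)) (γ : ℝ) (b f a : Space M → ℝ)
    (u : TracedH1 Ω) : Prop :=
  ∀ v : TracedH1 Ω,
    (∫ x in Ω, a x * inner ℝ (u.grad x) (v.grad x))
      + (∫ x, a x * γ * u.trace x * v.trace x ∂(surface Ω))
      - (∫ x in Ω, b x * u.val x * v.val x)
    = ∫ x in Ω, f x * v.val x

/-- The admissible coefficients: bounded measurable functions on `Ω` with values in `(lo, hi)`
almost everywhere, and with boundary values on `∂Ω₁`, again measurable and between the two bounds
(not strictly: passing to boundary values need not keep a strict inequality). As `∂Ω₁` is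
in general a Lebesgue null set, the two parts are independent data of `a`. -/
def admissible {M : ℕ} (Ω Ω₁ : Set (Space M)) (lo hi : ℝ) : Set (Space M → ℝ) :=
  {a | AEStronglyMeasurable a (volume.restrict Ω) ∧
    (∀ᵐ x ∂(volume.restrict Ω), lo < a x ∧ a x < hi) ∧
    AEStronglyMeasurable a (surface Ω₁) ∧
    (∀ᵐ x ∂(surface Ω₁), lo ≤ a x ∧ a x ≤ hi)}

/-- `C` is a constant in the Friedrichs inequality
`‖v‖²_{H¹(Ω)} ≤ C (∫_Ω |∇v|² + ∫_∂Ω v²)`. -/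
def IsFriedrichsConstant {M : ℕ} (Ω : Set (Space M)) (C : ℝ) : Prop :=
  ∀ v : TracedH1 Ω,
    (∫ x in Ω, v.val x ^ 2) + (∫ x in Ω, ‖v.grad x‖ ^ 2)
      ≤ C * ((∫ x in Ω, ‖v.grad x‖ ^ 2) + ∫ x, v.trace x ^ 2 ∂(surface Ω))

/-- The energy misfit of `u` with respect to the data `z`, for the coefficient `a`. -/
noncomputable def energy {M : ℕ} (Ω : Set (Space M)) (γ : ℝ) (b : Space M → ℝ)
    (z : TracedH1 Ω) (a : Space M → ℝ) (u : TracedH1 Ω) : ℝ :=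
  (1 / 2) * (∫ x in Ω, a x * ‖u.grad x - z.grad x‖ ^ 2)
    + (1 / 2) * (∫ x, a x * γ * (u.trace x - z.trace x) ^ 2 ∂(surface Ω))
    - (1 / 2) * (∫ x in Ω, b x * (u.val x - z.val x) ^ 2)

end RobinEnergy

/-! Values, gradients and traces of functions in `TracedH1` form a closed subspace `tracedSubmodule`
of the Hilbert space `Triple`, so the trace is part of the unknown and need not be determined by the
function. The Robin form `B_a` is bounded, symmetric and affine in `a`. Friedrichs' inequality and
the smallness of `b` make it coercive on that subspace (`exists_mul_norm_sq_le_robinForm`), and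
Lax-Milgram gives `U(a)`.

For convexity, write `l(v) = ∫ f v`. Testing the equation with `U(a)` and `z` gives `2 G(a) =
l(U(a)) - 2 l(z) + B_a(z, z)`. The last term is affine in `a`, and by coercivity and symmetry
`l(U(a))` is the maximum over `v` of `2 l(v) - B_a(v, v)`, a maximum of affine functions of `a`.
Hence no derivative of `U` is needed; `energy_misfit_convex_combination` is this argument on one
segment. -/

namespace RobinEnergy

/-! ### Quadratic forms on `L²` with bounded weights -/

section WeightedForm

variable {X F : Type*} [MeasurableSpace X] {μ : Measure X}
  [NormedAddCommGroup F] [InnerProductSpace ℝ F]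

/-- The bilinear form `(u, v) ↦ ∫ a ⟪u, v⟫` on `L²(μ; F)`, as a linear function of the bounded
weight `a`. -/
noncomputable def weightedForm (μ : Measure X) (F : Type*) [NormedAddCommGroup F]
    [InnerProductSpace ℝ F] : Lp ℝ ⊤ μ →L[ℝ] Lp F 2 μ →L[ℝ] Lp F 2 μ →L[ℝ] ℝ :=
  (ContinuousLinearMap.compL ℝ (Lp F 2 μ) (Lp F 2 μ) (Lp F 2 μ →L[ℝ] ℝ) (innerSL ℝ)) ∘L
    ((ContinuousLinearMap.lsmul ℝ ℝ).holderL μ ⊤ 2 2)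

theorem weightedForm_apply (a : Lp ℝ ⊤ μ) (u v : Lp F 2 μ) :
    weightedForm μ F a u v = ∫ x, a x * inner ℝ (u x) (v x) ∂μ := by
  change inner ℝ ((ContinuousLinearMap.lsmul ℝ ℝ).holder 2 a u) v = _
  rw [L2.inner_def]
  refine integral_congr_ae ?_
  filter_upwards [(ContinuousLinearMap.lsmul ℝ ℝ (E := F)).coeFn_holder (r := 2) a u] with x hx
  simp [hx, real_inner_smul_left]

theorem weightedForm_toLp {a : X → ℝ} (ha : MemLp a ⊤ μ) (u v : Lp F 2 μ) :
    weightedForm μ F (ha.toLp a) u v = ∫ x, a x * inner ℝ (u x) (v x) ∂μ := by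
  rw [weightedForm_apply]
  refine integral_congr_ae ?_
  filter_upwards [ha.coeFn_toLp] with x hx
  rw [hx]

theorem weightedForm_comm (a : Lp ℝ ⊤ μ) (u v : Lp F 2 μ) :
    weightedForm μ F a u v = weightedForm μ F a v u := by
  simp only [weightedForm_apply, real_inner_comm]

theorem norm_sq_eq_integral (u : Lp F 2 μ) : ‖u‖ ^ 2 = ∫ x, ‖u x‖ ^ 2 ∂μ := by
  rw [← real_inner_self_eq_norm_sq, L2.inner_def]
  simp only [real_inner_self_eq_norm_sq]

theorem integrable_weight_mul_norm_sq (a : Lp ℝ ⊤ μ) (u : Lp F 2 μ) :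
    Integrable (fun x => a x * ‖u x‖ ^ 2) μ := by
  refine (L2.integrable_inner (𝕜 := ℝ)
    ((ContinuousLinearMap.lsmul ℝ ℝ).holder 2 a u) u).congr ?_
  filter_upwards [(ContinuousLinearMap.lsmul ℝ ℝ (E := F)).coeFn_holder (r := 2) a u] with x hx
  simp [hx, real_inner_smul_left]

theorem integrable_norm_sq (u : Lp F 2 μ) : Integrable (fun x => ‖u x‖ ^ 2) μ := by
  simpa only [real_inner_self_eq_norm_sq] using L2.integrable_inner (𝕜 := ℝ) u u

theorem mul_norm_sq_le_weightedForm (a : Lp ℝ ⊤ μ) {k : ℝ} (h : ∀ᵐ x ∂μ, k ≤ a x)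
    (u : Lp F 2 μ) : k * ‖u‖ ^ 2 ≤ weightedForm μ F a u u := by
  rw [weightedForm_apply, norm_sq_eq_integral, ← integral_const_mul]
  simp only [real_inner_self_eq_norm_sq]
  refine integral_mono_ae ((integrable_norm_sq u).const_mul k)
    (integrable_weight_mul_norm_sq a u) ?_
  filter_upwards [h] with x hx
  gcongr

theorem weightedForm_le_mul_norm_sq (a : Lp ℝ ⊤ μ) {k : ℝ} (h : ∀ᵐ x ∂μ, a x ≤ k)
    (u : Lp F 2 μ) : weightedForm μ F a u u ≤ k * ‖u‖ ^ 2 := by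
  rw [weightedForm_apply, norm_sq_eq_integral, ← integral_const_mul]
  simp only [real_inner_self_eq_norm_sq]
  refine integral_mono_ae (integrable_weight_mul_norm_sq a u)
    ((integrable_norm_sq u).const_mul k) ?_
  filter_upwards [h] with x hx
  gcongr

end WeightedForm

/-! ### The traced Sobolev space as a closed subspace of a Hilbert space -/

variable {M : ℕ}

/-- Triples of square integrable functions: a function on `Ω`, a vector field on `Ω`, and a function
on the boundary. -/
abbrev Triple (Ω : Set (Space M)) : Type :=
  WithLp 2 (Lp ℝ 2 (volume.restrict Ω) ×
    WithLp 2 (Lp (Space M) 2 (volume.restrict Ω) × Lp ℝ 2 (surface Ω)))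

variable {Ω : Set (Space M)}

theorem Triple.norm_sq (p : Triple Ω) :
    ‖p‖ ^ 2 = ‖p.fst‖ ^ 2 + ‖p.snd.fst‖ ^ 2 + ‖p.snd.snd‖ ^ 2 := by
  rw [WithLp.prod_norm_sq_eq_of_L2, WithLp.prod_norm_sq_eq_of_L2 p.snd, add_assoc]

/-- The triple of values, gradient and trace. -/
noncomputable def TracedH1.toTriple (u : TracedH1 Ω) : Triple Ω :=
  WithLp.toLp 2 (u.val, WithLp.toLp 2 (u.grad, u.trace))

theorem TracedH1.toTriple_injective :
    Function.Injective (TracedH1.toTriple : TracedH1 Ω → Triple Ω) := by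
  rintro ⟨⟨u, w, hu⟩, g, hg⟩ ⟨⟨u', w', hu'⟩, g', hg'⟩ h
  obtain rfl : u = u' := congrArg WithLp.fst h
  obtain rfl : w = w' := congrArg (fun p : Triple Ω => p.snd.fst) h
  obtain rfl : g = g' := congrArg (fun p : Triple Ω => p.snd.snd) h
  rfl

theorem memLp_two_of_continuous {F : Type*} [NormedAddCommGroup F] {φ : Space M → F}
    (hφ : Continuous φ) (hc : HasCompactSupport φ) : MemLp φ 2 (volume.restrict Ω) :=
  (hφ.memLp_of_hasCompactSupport hc).restrict Ω

theorem memLp_fderiv_apply {φ : Space M → ℝ} (hφ : ContDiff ℝ ∞ φ) (hc : HasCompactSupport φ)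
    (i : Fin M) :
    MemLp (fun x => fderiv ℝ φ x (EuclideanSpace.single i 1)) 2 (volume.restrict Ω) :=
  memLp_two_of_continuous ((hφ.continuous_fderiv (by simp)).clm_apply continuous_const)
    (hc.fderiv_apply ℝ _)

theorem memLp_smul_single {φ : Space M → ℝ} (hφ : ContDiff ℝ ∞ φ) (hc : HasCompactSupport φ)
    (i : Fin M) :
    MemLp (fun x => φ x • (EuclideanSpace.single i 1 : Space M)) 2 (volume.restrict Ω) :=
  memLp_two_of_continuous (hφ.continuous.smul continuous_const) hc.smul_right

/-- Pairing with fixed `L²` functions turns each test identity into the vanishing of a continuous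
linear functional, so linearity and closedness of the weak gradient relation come for free. -/
theorem weakGrad_identity_iff {φ : Space M → ℝ} (hφ : ContDiff ℝ ∞ φ) (hc : HasCompactSupport φ)
    (i : Fin M) (u : Lp ℝ 2 (volume.restrict Ω)) (w : Lp (Space M) 2 (volume.restrict Ω)) :
    (∫ x in Ω, u x * fderiv ℝ φ x (EuclideanSpace.single i 1) = - ∫ x in Ω, w x i * φ x) ↔
      inner ℝ ((memLp_fderiv_apply hφ hc i).toLp _) u
        + inner ℝ ((memLp_smul_single hφ hc i).toLp _) w = 0 := by
  rw [eq_neg_iff_add_eq_zero, L2.inner_def, L2.inner_def]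
  have h₁ : ∫ x in Ω, inner ℝ ((memLp_fderiv_apply (Ω := Ω) hφ hc i).toLp _ x) (u x)
      = ∫ x in Ω, u x * fderiv ℝ φ x (EuclideanSpace.single i 1) := by
    refine integral_congr_ae ?_
    filter_upwards [(memLp_fderiv_apply (Ω := Ω) hφ hc i).coeFn_toLp] with x hx
    rw [hx]; rfl
  have h₂ : ∫ x in Ω, inner ℝ ((memLp_smul_single (Ω := Ω) hφ hc i).toLp _ x) (w x)
      = ∫ x in Ω, w x i * φ x := by
    refine integral_congr_ae ?_
    filter_upwards [(memLp_smul_single (Ω := Ω) hφ hc i).coeFn_toLp] with x hx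
    simp [hx, real_inner_smul_left, EuclideanSpace.inner_single_left, mul_comm]
  rw [h₁, h₂]

/-- The functions paired with their weak gradients form a subspace. -/
def weakGradSubmodule (Ω : Set (Space M)) : Submodule ℝ (Triple Ω) where
  carrier := {p | IsWeakGrad Ω p.fst p.snd.fst}
  zero_mem' φ hφ hc _ i := (weakGrad_identity_iff hφ hc i 0 0).2 (by simp)
  add_mem' {p q} hp hq φ hφ hc hs i := by
    refine (weakGrad_identity_iff hφ hc i (p + q).fst (p + q).snd.fst).2 ?_
    have h₁ := (weakGrad_identity_iff hφ hc i _ _).1 (hp φ hφ hc hs i)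
    have h₂ := (weakGrad_identity_iff hφ hc i _ _).1 (hq φ hφ hc hs i)
    simp only [WithLp.add_fst, WithLp.add_snd, inner_add_right]
    linarith
  smul_mem' k p hp φ hφ hc hs i := by
    refine (weakGrad_identity_iff hφ hc i (k • p).fst (k • p).snd.fst).2 ?_
    have h := (weakGrad_identity_iff hφ hc i _ _).1 (hp φ hφ hc hs i)
    simp only [WithLp.smul_fst, WithLp.smul_snd, real_inner_smul_right]
    rw [← mul_add, h, mul_zero]

theorem mem_weakGradSubmodule {p : Triple Ω} :
    p ∈ weakGradSubmodule Ω ↔ IsWeakGrad Ω p.fst p.snd.fst := Iff.rfl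

theorem isClosed_weakGradSubmodule : IsClosed (weakGradSubmodule Ω : Set (Triple Ω)) := by
  have h : (weakGradSubmodule Ω : Set (Triple Ω)) =
      ⋂ (φ : Space M → ℝ) (hφ : ContDiff ℝ ∞ φ) (hc : HasCompactSupport φ)
        (_ : tsupport φ ⊆ Ω) (i : Fin M),
        {p : Triple Ω | inner ℝ ((memLp_fderiv_apply hφ hc i).toLp _) p.fst
          + inner ℝ ((memLp_smul_single hφ hc i).toLp _) p.snd.fst = 0} := by
    ext p
    simp only [SetLike.mem_coe, mem_weakGradSubmodule, IsWeakGrad, Set.mem_iInter,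
      Set.mem_ofPred_eq]
    refine forall_congr' fun φ => forall_congr' fun hφ => forall_congr' fun hc =>
      forall_congr' fun _ => forall_congr' fun i => weakGrad_identity_iff hφ hc i _ _
  rw [h]
  refine isClosed_iInter fun φ => isClosed_iInter fun hφ => isClosed_iInter fun hc =>
    isClosed_iInter fun _ => isClosed_iInter fun i => isClosed_eq ?_ continuous_const
  fun_prop

/-- The triples of functions in `H¹(Ω)` that are continuous up to the boundary. -/
noncomputable def continuousSubmodule (Ω : Set (Space M)) : Submodule ℝ (Triple Ω) where
  carrier := {p | p ∈ weakGradSubmodule Ω ∧ ∃ c : Space M → ℝ, ContinuousOn c (closure Ω) ∧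
    p.fst =ᵐ[volume.restrict Ω] c ∧ p.snd.snd =ᵐ[surface Ω] c}
  zero_mem' := ⟨zero_mem _, 0, continuousOn_const, Lp.coeFn_zero _ _ _, Lp.coeFn_zero _ _ _⟩
  add_mem' := by
    rintro p q ⟨hp, c, hc, hp₁, hp₂⟩ ⟨hq, d, hd, hq₁, hq₂⟩
    exact ⟨add_mem hp hq, c + d, hc.add hd, (Lp.coeFn_add _ _).trans (hp₁.add hq₁),
      (Lp.coeFn_add _ _).trans (hp₂.add hq₂)⟩
  smul_mem' := by
    rintro k p ⟨hp, c, hc, hp₁, hp₂⟩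
    exact ⟨Submodule.smul_mem _ k hp, k • c, hc.const_smul k,
      (Lp.coeFn_smul _ _).trans (hp₁.const_smul k), (Lp.coeFn_smul _ _).trans (hp₂.const_smul k)⟩

/-- The triples of values, gradient and trace of functions in `H¹(Ω)`. -/
noncomputable def tracedSubmodule (Ω : Set (Space M)) : Submodule ℝ (Triple Ω) :=
  (continuousSubmodule Ω).topologicalClosure

theorem TracedH1.toTriple_mem (u : TracedH1 Ω) : u.toTriple ∈ tracedSubmodule Ω := by
  obtain ⟨φ, t, c, hc, hval, hgrad, ht⟩ := u.hasTrace
  refine mem_closure_of_tendsto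
    (f := fun n => (WithLp.toLp 2 ((φ n).val, WithLp.toLp 2 ((φ n).grad, t n)) : Triple Ω))
    (b := atTop) ?_ (Eventually.of_forall fun n => ⟨(φ n).isWeakGrad, c n, hc n⟩)
  exact ((WithLp.prod_continuous_toLp 2 _ _).tendsto _).comp
    (hval.prodMk_nhds (((WithLp.prod_continuous_toLp 2 _ _).tendsto _).comp
      (hgrad.prodMk_nhds ht)))

/-- The weak gradient relation survives the closure, and a sequence realizing `p` as a limit is
exactly what `H1.HasTrace` asks for. -/
theorem exists_toTriple_eq {p : Triple Ω} (hp : p ∈ tracedSubmodule Ω) :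
    ∃ u : TracedH1 Ω, u.toTriple = p := by
  have hw : p ∈ weakGradSubmodule Ω :=
    closure_minimal (fun q hq => hq.1) isClosed_weakGradSubmodule hp
  obtain ⟨q, hq, hlim⟩ := mem_closure_iff_seq_limit.1 hp
  choose hqw c hc using hq
  have hsnd := ((WithLp.continuous_snd 2 _ _).tendsto p).comp hlim
  exact ⟨⟨⟨p.fst, p.snd.fst, hw⟩, p.snd.snd,
    fun n => ⟨(q n).fst, (q n).snd.fst, hqw n⟩, fun n => (q n).snd.snd, c, hc,
    ((WithLp.continuous_fst 2 _ _).tendsto p).comp hlim,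
    ((WithLp.continuous_fst 2 _ _).tendsto p.snd).comp hsnd,
    ((WithLp.continuous_snd 2 _ _).tendsto p.snd).comp hsnd⟩, rfl⟩

/-! ### The Robin form and its coercivity -/

variable {Ω' : Set (Space M)}

/-- The bilinear form `∫_Ω α ∇u·∇v + γ ∫_∂Ω τ u v - ∫_Ω β u v`. -/
noncomputable def robinForm (Ω : Set (Space M)) (γ : ℝ) (α : Lp ℝ ⊤ (volume.restrict Ω))
    (τ : Lp ℝ ⊤ (surface Ω)) (β : Lp ℝ ⊤ (volume.restrict Ω)) :
    Triple Ω →L[ℝ] Triple Ω →L[ℝ] ℝ :=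
  letI val : Triple Ω →L[ℝ] Lp ℝ 2 (volume.restrict Ω) := WithLp.fstL 2 ℝ _ _
  letI grad : Triple Ω →L[ℝ] Lp (Space M) 2 (volume.restrict Ω) :=
    (WithLp.fstL 2 ℝ _ _) ∘L (WithLp.sndL 2 ℝ _ _)
  letI tr : Triple Ω →L[ℝ] Lp ℝ 2 (surface Ω) :=
    (WithLp.sndL 2 ℝ _ _) ∘L (WithLp.sndL 2 ℝ _ _)
  (weightedForm _ _ α).bilinearComp grad grad + γ • (weightedForm _ _ τ).bilinearComp tr tr
    - (weightedForm _ _ β).bilinearComp val val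

section RobinForm

variable {γ : ℝ} {α α' β : Lp ℝ ⊤ (volume.restrict Ω)} {τ τ' : Lp ℝ ⊤ (surface Ω)}

theorem robinForm_apply (p q : Triple Ω) :
    robinForm Ω γ α τ β p q = weightedForm _ _ α p.snd.fst q.snd.fst
      + γ * weightedForm _ _ τ p.snd.snd q.snd.snd - weightedForm _ _ β p.fst q.fst := rfl

theorem robinForm_comm (p q : Triple Ω) :
    robinForm Ω γ α τ β p q = robinForm Ω γ α τ β q p := by
  simp only [robinForm_apply, weightedForm_comm _ p.fst, weightedForm_comm _ p.snd.fst,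
    weightedForm_comm _ p.snd.snd]

theorem robinForm_convex_combination {s t : ℝ} (hst : s + t = 1) (p q : Triple Ω) :
    robinForm Ω γ (s • α + t • α') (s • τ + t • τ') β p q
      = s * robinForm Ω γ α τ β p q + t * robinForm Ω γ α' τ' β p q := by
  obtain rfl : t = 1 - s := by linarith
  simp only [robinForm_apply, map_add, map_smul, add_apply,
    smul_apply, smul_eq_mul]
  ring

theorem norm_sq_le_of_isFriedrichsConstant {C : ℝ} (hF : IsFriedrichsConstant Ω C) {p : Triple Ω}
    (hp : p ∈ tracedSubmodule Ω) :
    ‖p.fst‖ ^ 2 + ‖p.snd.fst‖ ^ 2 ≤ C * (‖p.snd.fst‖ ^ 2 + ‖p.snd.snd‖ ^ 2) := by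
  obtain ⟨u, rfl⟩ := exists_toTriple_eq hp
  change ‖u.val‖ ^ 2 + ‖u.grad‖ ^ 2 ≤ C * (‖u.grad‖ ^ 2 + ‖u.trace‖ ^ 2)
  simpa only [norm_sq_eq_integral, Real.norm_eq_abs, sq_abs] using hF u

/-- Friedrichs' inequality enters twice: it absorbs `W ≤ bbar * C * (g + r)` into `A + T ≥ lo * min
1 γ * (g + r)`, and it gives `v + g + r ≤ (C + 1) * (g + r)`, whence the divisor `C + 1`. -/
theorem coercivity_bound {γ lo bbar C v g r A T W : ℝ} (hC : 0 < C) (hlo : 0 < lo)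
    (hbbar : 0 ≤ bbar) (hpos : 0 < lo * min 1 γ - bbar * C) (hg : 0 ≤ g) (hr : 0 ≤ r)
    (hF : v + g ≤ C * (g + r)) (hA : lo * g ≤ A) (hT : γ * (lo * r) ≤ T) (hW : W ≤ bbar * v) :
    (lo * min 1 γ - bbar * C) / (C + 1) * (v + g + r) ≤ A + T - W := by
  have h₁ : lo * min 1 γ * g ≤ lo * g :=
    mul_le_mul_of_nonneg_right (mul_le_of_le_one_right hlo.le (min_le_left 1 γ)) hg
  have h₂ : lo * min 1 γ * r ≤ γ * (lo * r) := by
    have := mul_le_mul_of_nonneg_left (min_le_right 1 γ) (mul_nonneg hlo.le hr)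
    linarith
  have h₃ : bbar * v ≤ bbar * (C * (g + r)) := mul_le_mul_of_nonneg_left (by linarith) hbbar
  calc (lo * min 1 γ - bbar * C) / (C + 1) * (v + g + r)
      ≤ (lo * min 1 γ - bbar * C) / (C + 1) * ((C + 1) * (g + r)) :=
        mul_le_mul_of_nonneg_left (by linarith) (by positivity)
    _ = (lo * min 1 γ - bbar * C) * (g + r) := by field_simp
    _ ≤ _ := by linarith

theorem exists_mul_norm_sq_le_robinForm {C lo bbar : ℝ} (hγ : 0 < γ) (hlo : 0 < lo) (hC : 0 < C)
    (hF : IsFriedrichsConstant Ω C) (hbbar : 0 ≤ bbar) (hsmall : bbar < lo * min 1 γ / C)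
    (hα : ∀ᵐ x ∂(volume.restrict Ω), lo ≤ α x) (hτ : ∀ᵐ x ∂(surface Ω), lo ≤ τ x)
    (hβ : ∀ᵐ x ∂(volume.restrict Ω), β x ≤ bbar) :
    ∃ k, 0 < k ∧ ∀ p ∈ tracedSubmodule Ω, k * ‖p‖ ^ 2 ≤ robinForm Ω γ α τ β p p := by
  have hpos : 0 < lo * min 1 γ - bbar * C := sub_pos.2 ((lt_div_iff₀ hC).1 hsmall)
  refine ⟨(lo * min 1 γ - bbar * C) / (C + 1), div_pos hpos (by linarith), fun p hp => ?_⟩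
  rw [Triple.norm_sq, robinForm_apply]
  exact coercivity_bound hC hlo hbbar hpos (sq_nonneg _) (sq_nonneg _)
    (norm_sq_le_of_isFriedrichsConstant hF hp) (mul_norm_sq_le_weightedForm α hα p.snd.fst)
    (mul_le_mul_of_nonneg_left (mul_norm_sq_le_weightedForm τ hτ p.snd.snd) hγ.le)
    (weightedForm_le_mul_norm_sq β hβ p.fst)

/-! ### Solvability by Lax-Milgram -/

/-- The Lax-Milgram theorem, for a functional on the right-hand side. -/
theorem existsUnique_apply_eq_of_isCoercive {V : Type*} [NormedAddCommGroup V]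
    [InnerProductSpace ℝ V] [CompleteSpace V] {B : V →L[ℝ] V →L[ℝ] ℝ} (hB : IsCoercive B)
    (l : V →L[ℝ] ℝ) : ∃! u : V, ∀ v : V, B u v = l v := by
  set y := (InnerProductSpace.toDual ℝ V).symm l with hy
  have hl : ∀ v, inner ℝ y v = l v := fun v => InnerProductSpace.toDual_symm_apply
  refine ⟨hB.continuousLinearEquivOfBilin.symm y, fun v => ?_, fun w hw => ?_⟩
  · rw [← hB.continuousLinearEquivOfBilin_apply, ContinuousLinearEquiv.apply_symm_apply, hl]
  · rw [ContinuousLinearEquiv.eq_symm_apply]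
    exact (hB.unique_continuousLinearEquivOfBilin fun v => by rw [hl, hw]).symm

theorem existsUnique_mem_apply_eq_of_coercive_on {E : Type*} [NormedAddCommGroup E]
    [InnerProductSpace ℝ E] [CompleteSpace E] {S : Submodule ℝ E} (hS : IsClosed (S : Set E))
    {B : E →L[ℝ] E →L[ℝ] ℝ} {k : ℝ} (hk : 0 < k) (hcoer : ∀ p ∈ S, k * ‖p‖ ^ 2 ≤ B p p)
    (l : E →L[ℝ] ℝ) : ∃! u, u ∈ S ∧ ∀ v ∈ S, B u v = l v := by
  have : CompleteSpace S := hS.completeSpace_coe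
  have hco : IsCoercive (B.bilinearComp S.subtypeL S.subtypeL) := ⟨k, hk, fun p => by
    rw [mul_assoc, ← sq]
    exact hcoer p p.2⟩
  obtain ⟨p, hp, huniq⟩ := existsUnique_apply_eq_of_isCoercive hco (l ∘L S.subtypeL)
  exact ⟨p, ⟨p.2, fun v hv => hp ⟨v, hv⟩⟩, fun w hw =>
    congrArg Subtype.val (huniq ⟨w, hw.1⟩ fun v => hw.2 v v.2)⟩

theorem existsUnique_apply_eq_of_coercive_on {B : Triple Ω →L[ℝ] Triple Ω →L[ℝ] ℝ} {k : ℝ}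
    (hk : 0 < k) (hcoer : ∀ p ∈ tracedSubmodule Ω, k * ‖p‖ ^ 2 ≤ B p p)
    (l : Triple Ω →L[ℝ] ℝ) :
    ∃! u : TracedH1 Ω, ∀ v : TracedH1 Ω, B u.toTriple v.toTriple = l v.toTriple := by
  obtain ⟨p, ⟨hpS, hp⟩, huniq⟩ := existsUnique_mem_apply_eq_of_coercive_on
    (Submodule.isClosed_topologicalClosure _) hk hcoer l
  obtain ⟨u, rfl⟩ := exists_toTriple_eq hpS
  refine ⟨u, fun v => hp _ v.toTriple_mem, fun w hw => TracedH1.toTriple_injective ?_⟩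
  refine huniq _ ⟨w.toTriple_mem, fun q hq => ?_⟩
  obtain ⟨v, rfl⟩ := exists_toTriple_eq hq
  exact hw v

end RobinForm

/-! ### Admissible coefficients, and integrals as values of the form -/

theorem memLp_top_of_mem_Icc {X : Type*} [MeasurableSpace X] {μ : Measure X} {a : X → ℝ}
    {lo hi : ℝ} (ha : AEStronglyMeasurable a μ) (h : ∀ᵐ x ∂μ, lo ≤ a x ∧ a x ≤ hi) :
    MemLp a ⊤ μ := by
  refine memLp_top_of_bound ha (max |lo| |hi|) ?_
  filter_upwards [h] with x hx
  exact abs_le_max_abs_abs hx.1 hx.2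

section Admissible

variable {a : Space M → ℝ} {lo hi : ℝ}

theorem ae_mem_Icc_of_mem_admissible (hsub : Ω ⊆ Ω') (ha : a ∈ admissible Ω' Ω lo hi) :
    ∀ᵐ x ∂(volume.restrict Ω), lo ≤ a x ∧ a x ≤ hi :=
  (ae_restrict_of_ae_restrict_of_subset hsub ha.2.1).mono fun _ hx => ⟨hx.1.le, hx.2.le⟩

theorem memLp_volume_of_mem_admissible (hsub : Ω ⊆ Ω') (ha : a ∈ admissible Ω' Ω lo hi) :
    MemLp a ⊤ (volume.restrict Ω) :=
  memLp_top_of_mem_Icc (ha.1.mono_measure (Measure.restrict_mono_set _ hsub))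
    (ae_mem_Icc_of_mem_admissible hsub ha)

theorem memLp_surface_of_mem_admissible (ha : a ∈ admissible Ω' Ω lo hi) :
    MemLp a ⊤ (surface Ω) :=
  memLp_top_of_mem_Icc ha.2.2.1 ha.2.2.2

theorem convex_admissible (Ω' Ω : Set (Space M)) (lo hi : ℝ) :
    Convex ℝ (admissible Ω' Ω lo hi) := by
  rintro a ⟨ha₁, ha₂, ha₃, ha₄⟩ a' ⟨ha'₁, ha'₂, ha'₃, ha'₄⟩ s t hs ht hst
  refine ⟨(ha₁.const_smul s).add (ha'₁.const_smul t), ?_,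
    (ha₃.const_smul s).add (ha'₃.const_smul t), ?_⟩
  · filter_upwards [ha₂, ha'₂] with x hx hx'
    exact convex_Ioo lo hi hx hx' hs ht hst
  · filter_upwards [ha₄, ha'₄] with x hx hx'
    exact convex_Icc lo hi hx hx' hs ht hst

end Admissible

section Integrals

variable {γ : ℝ} {a b f : Space M → ℝ}

theorem isWeakSolution_iff (haΩ : MemLp a ⊤ (volume.restrict Ω)) (ha : MemLp a ⊤ (surface Ω))
    (hb : MemLp b ⊤ (volume.restrict Ω)) (hf : MemLp f 2 (volume.restrict Ω)) (u : TracedH1 Ω) :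
    IsWeakSolution Ω γ b f a u ↔ ∀ v : TracedH1 Ω,
      robinForm Ω γ (haΩ.toLp a) (ha.toLp a) (hb.toLp b) u.toTriple v.toTriple
        = innerSL ℝ (hf.toLp f) v.val := by
  refine forall_congr' fun v => ?_
  have hfv : innerSL ℝ (hf.toLp f) v.val = ∫ x in Ω, f x * v.val x := by
    rw [innerSL_apply_apply, L2.inner_def]
    refine integral_congr_ae ?_
    filter_upwards [hf.coeFn_toLp] with x hx
    simp [hx, mul_comm]
  rw [hfv, robinForm_apply, weightedForm_toLp, weightedForm_toLp, weightedForm_toLp,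
    ← integral_const_mul]
  simp only [TracedH1.toTriple, WithLp.toLp_fst, WithLp.toLp_snd, RCLike.inner_apply,
    conj_trivial]
  have h₁ : ∀ x, a x * γ * u.trace x * v.trace x = γ * (a x * (v.trace x * u.trace x)) :=
    fun x => by ring
  have h₂ : ∀ x, b x * u.val x * v.val x = b x * (v.val x * u.val x) := fun x => by ring
  simp only [h₁, h₂]

theorem energy_eq_robinForm (haΩ : MemLp a ⊤ (volume.restrict Ω)) (ha : MemLp a ⊤ (surface Ω))
    (hb : MemLp b ⊤ (volume.restrict Ω)) (z u : TracedH1 Ω) :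
    energy Ω γ b z a u = (1 / 2) * robinForm Ω γ (haΩ.toLp a) (ha.toLp a) (hb.toLp b)
      (u.toTriple - z.toTriple) (u.toTriple - z.toTriple) := by
  rw [robinForm_apply, weightedForm_toLp, weightedForm_toLp, weightedForm_toLp,
    ← integral_const_mul, energy, mul_sub, mul_add]
  congr 1
  · congr 1 <;> congr 1 <;> refine integral_congr_ae ?_
    · filter_upwards [Lp.coeFn_sub u.grad z.grad] with x hx
      change _ = a x * inner ℝ ((u.grad - z.grad) x) ((u.grad - z.grad) x)
      rw [hx, real_inner_self_eq_norm_sq, Pi.sub_apply]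
    · filter_upwards [Lp.coeFn_sub u.trace z.trace] with x hx
      change _ = γ * (a x * inner ℝ ((u.trace - z.trace) x) ((u.trace - z.trace) x))
      rw [hx, real_inner_self_eq_norm_sq, Pi.sub_apply, Real.norm_eq_abs, sq_abs]
      ring
  · congr 1
    refine integral_congr_ae ?_
    filter_upwards [Lp.coeFn_sub u.val z.val] with x hx
    change _ = b x * inner ℝ ((u.val - z.val) x) ((u.val - z.val) x)
    rw [hx, real_inner_self_eq_norm_sq, Pi.sub_apply, Real.norm_eq_abs, sq_abs]

end Integrals

/-! ### Convexity of the energy misfit -/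

section EnergyMisfit

variable {E : Type*} [NormedAddCommGroup E] [NormedSpace ℝ E]

theorem apply_sub_apply_sub_of_symm {B : E →L[ℝ] E →L[ℝ] ℝ} (hB : ∀ p q, B p q = B q p)
    (p q : E) : B (p - q) (p - q) = B p p - 2 * B p q + B q q := by
  simp only [map_sub, sub_apply, hB q p]
  ring

/-- For symmetric bilinear forms `B₁`, `B₂` that are nonnegative on differences of Galerkin
solutions, the energy misfit of the solution is convex along the segment from `B₁` to `B₂`. -/
theorem energy_misfit_convex_combination {B₁ B₂ B : E →L[ℝ] E →L[ℝ] ℝ} {l : E →L[ℝ] ℝ} {s t : ℝ}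
    (hs : 0 ≤ s) (ht : 0 ≤ t) (hst : s + t = 1)
    (h₁ : ∀ p q, B₁ p q = B₁ q p) (h₂ : ∀ p q, B₂ p q = B₂ q p)
    (hB : ∀ p q, B p q = s * B₁ p q + t * B₂ p q) {u₁ u₂ u z : E}
    (hu₁ : ∀ v ∈ ({u₁, u, z} : Set E), B₁ u₁ v = l v)
    (hu₂ : ∀ v ∈ ({u₂, u, z} : Set E), B₂ u₂ v = l v)
    (hu : ∀ v ∈ ({u, z} : Set E), B u v = l v)
    (hpos₁ : 0 ≤ B₁ (u₁ - u) (u₁ - u)) (hpos₂ : 0 ≤ B₂ (u₂ - u) (u₂ - u)) :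
    B (u - z) (u - z) ≤ s * B₁ (u₁ - z) (u₁ - z) + t * B₂ (u₂ - z) (u₂ - z) := by
  have hsymm : ∀ p q, B p q = B q p := fun p q => by rw [hB, hB, h₁, h₂]
  -- Since `B₁ u₁ u₁ = l u₁`, nonnegativity becomes `2 * l u - B₁ u u ≤ l u₁`: the competitor `u` in
  -- the variational characterization of `l u₁`.
  rw [apply_sub_apply_sub_of_symm h₁, hu₁ u (by simp)] at hpos₁
  rw [apply_sub_apply_sub_of_symm h₂, hu₂ u (by simp)] at hpos₂
  rw [apply_sub_apply_sub_of_symm h₁, apply_sub_apply_sub_of_symm h₂,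
    apply_sub_apply_sub_of_symm hsymm, hu₁ z (by simp), hu₂ z (by simp), hu z (by simp), hB z z]
  have huu := hu u (by simp)
  have h := hB u u
  -- The weighted sum of the two competitor bounds is `2 * l u - B u u = l u` on the left; the terms
  -- in `z` agree on both sides.
  have := mul_nonneg hs hpos₁
  have := mul_nonneg ht hpos₂
  obtain rfl : t = 1 - s := by linarith
  nlinarith

end EnergyMisfit

end RobinEnergy

theorem lemma2p4 (M : ℕ) (hM : 1 ≤ M) (Ω Ω₁ : Set (RobinEnergy.Space M))
    (hΩ : IsOpen Ω) (hΩ₁ : IsOpen Ω₁) (hbdd : Bornology.IsBounded Ω₁) (hconn : IsConnected Ω₁)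
    (hsub : Ω₁ ⊆ Ω)
    (γ lo hi bbar CF : ℝ) (hγ : 0 < γ) (hlo : 0 < lo) (hbbar : 0 < bbar) (hCF : 0 < CF)
    (hF : RobinEnergy.IsFriedrichsConstant Ω₁ CF)
    (hsmall : bbar < lo * min 1 γ / CF)
    (f b : RobinEnergy.Space M → ℝ)
    (hf : MemLp f ⊤ (volume.restrict Ω)) (hb : MemLp b ⊤ (volume.restrict Ω))
    (hb' : ∀ᵐ x ∂(volume.restrict Ω), 0 < b x ∧ b x < bbar)
    (z : RobinEnergy.TracedH1 Ω₁) :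
    (∀ a ∈ RobinEnergy.admissible Ω Ω₁ lo hi,
      ∃! u : RobinEnergy.TracedH1 Ω₁, RobinEnergy.IsWeakSolution Ω₁ γ b f a u) ∧
    ∀ U : (RobinEnergy.Space M → ℝ) → RobinEnergy.TracedH1 Ω₁,
      (∀ a ∈ RobinEnergy.admissible Ω Ω₁ lo hi,
        RobinEnergy.IsWeakSolution Ω₁ γ b f a (U a)) →
      ConvexOn ℝ (RobinEnergy.admissible Ω Ω₁ lo hi)
        (fun a => RobinEnergy.energy Ω₁ γ b z a (U a)) := by
  open RobinEnergy in
  have : IsFiniteMeasure (volume.restrict Ω₁) :=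
    isFiniteMeasure_restrict.2 hbdd.measure_lt_top.ne
  have hmono := Measure.restrict_mono_set (volume : Measure (Space M)) hsub
  have hf₂ : MemLp f 2 (volume.restrict Ω₁) := (hf.mono_measure hmono).mono_exponent le_top
  have hb₁ : MemLp b ⊤ (volume.restrict Ω₁) := hb.mono_measure hmono
  set l : Triple Ω₁ →L[ℝ] ℝ := innerSL ℝ (hf₂.toLp f) ∘L WithLp.fstL 2 ℝ _ _
  have hcoer : ∀ (a : Space M → ℝ) (ha : a ∈ admissible Ω Ω₁ lo hi), ∃ k, 0 < k ∧
      ∀ p ∈ tracedSubmodule Ω₁, k * ‖p‖ ^ 2 ≤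
        robinForm Ω₁ γ ((memLp_volume_of_mem_admissible hsub ha).toLp a)
          ((memLp_surface_of_mem_admissible ha).toLp a) (hb₁.toLp b) p p := by
    intro a ha
    refine exists_mul_norm_sq_le_robinForm hγ hlo hCF hF hbbar.le hsmall ?_ ?_ ?_
    · filter_upwards [(memLp_volume_of_mem_admissible hsub ha).coeFn_toLp,
        ae_mem_Icc_of_mem_admissible hsub ha] with x hx hx'
      exact hx ▸ hx'.1
    · filter_upwards [(memLp_surface_of_mem_admissible ha).coeFn_toLp, ha.2.2.2] with x hx hx'
      exact hx ▸ hx'.1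
    · filter_upwards [hb₁.coeFn_toLp, ae_restrict_of_ae_restrict_of_subset hsub hb']
        with x hx hx'
      exact hx ▸ hx'.2.le
  have hweak : ∀ (a : Space M → ℝ) (ha : a ∈ admissible Ω Ω₁ lo hi) (u : TracedH1 Ω₁),
      IsWeakSolution Ω₁ γ b f a u ↔ ∀ v : TracedH1 Ω₁,
        robinForm Ω₁ γ ((memLp_volume_of_mem_admissible hsub ha).toLp a)
          ((memLp_surface_of_mem_admissible ha).toLp a) (hb₁.toLp b) u.toTriple v.toTriple
          = l v.toTriple :=
    fun a ha u => isWeakSolution_iff _ _ hb₁ hf₂ u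
  refine ⟨fun a ha => ?_, fun U hU => ⟨convex_admissible Ω Ω₁ lo hi, ?_⟩⟩
  · obtain ⟨k, hk, hk'⟩ := hcoer a ha
    simp only [hweak a ha]
    exact existsUnique_apply_eq_of_coercive_on hk hk' l
  · intro a ha a' ha' s t hs ht hst
    have hc := convex_admissible Ω Ω₁ lo hi ha ha' hs ht hst
    have hnonneg : ∀ (e : Space M → ℝ) (he : e ∈ admissible Ω Ω₁ lo hi) (u v : TracedH1 Ω₁),
        0 ≤ robinForm Ω₁ γ ((memLp_volume_of_mem_admissible hsub he).toLp e)
          ((memLp_surface_of_mem_admissible he).toLp e) (hb₁.toLp b)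
          (u.toTriple - v.toTriple) (u.toTriple - v.toTriple) := by
      intro e he u v
      obtain ⟨k, hk, hk'⟩ := hcoer e he
      exact (by positivity : 0 ≤ k * ‖u.toTriple - v.toTriple‖ ^ 2).trans
        (hk' _ (sub_mem u.toTriple_mem v.toTriple_mem))
    have hsol := fun (e : Space M → ℝ) (he : e ∈ admissible Ω Ω₁ lo hi) =>
      (hweak e he (U e)).1 (hU e he)
    -- The form here carries the combination of the `L^∞` classes of `a` and `a'`; it agrees
    -- definitionally with the form for the class of `s • a + t • a'`, for which the equation is
    -- known.
    have key := energy_misfit_convex_combination (z := z.toTriple) hs ht hst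
      robinForm_comm robinForm_comm
      (fun p q => robinForm_convex_combination (γ := γ) (β := hb₁.toLp b)
        (α := (memLp_volume_of_mem_admissible hsub ha).toLp a)
        (α' := (memLp_volume_of_mem_admissible hsub ha').toLp a')
        (τ := (memLp_surface_of_mem_admissible ha).toLp a)
        (τ' := (memLp_surface_of_mem_admissible ha').toLp a') hst p q)
      (u₁ := (U a).toTriple) (u₂ := (U a').toTriple) (u := (U (s • a + t • a')).toTriple)
      (l := l) (by simp [hsol a ha]) (by simp [hsol a' ha'])
      (by
        have h := hsol _ hc
        rintro v (rfl | rfl)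
        · exact h _
        · exact h _)
      (hnonneg a ha _ _) (hnonneg a' ha' _ _)
    simp only [energy_eq_robinForm (memLp_volume_of_mem_admissible hsub ha)
        (memLp_surface_of_mem_admissible ha) hb₁,
      energy_eq_robinForm (memLp_volume_of_mem_admissible hsub ha')
        (memLp_surface_of_mem_admissible ha') hb₁,
      energy_eq_robinForm (memLp_volume_of_mem_admissible hsub hc)
        (memLp_surface_of_mem_admissible hc) hb₁, smul_eq_mul]
    rw [mul_left_comm s, mul_left_comm t, ← mul_add]
    exact mul_le_mul_of_nonneg_left key (by norm_num)
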